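/- Let $G$ be a finite simple unicyclic graph, i.e. a finite simple connected graph containing exactly one cycle. Let $d(G)$ be its diameter (the largest distance between two vertices of $G$) and let $r$ be its girth (the length of its unique cycle). Let $m_G[0,1)$ denote the number of eigenvalues, counted with multiplicity, of the Laplacian matrix $L(G)=D(G)-A(G)$ that lie in the interval $[0,1)$, where $D(G)$ is the diagonal matrix of vertex degrees and $A(G)$ is the adjacency matrix. Then $$m_G[0,1)\;\ge\;\left\lceil\frac{d(G)}{3}\right\rceil+\left\lceil\frac{r}{6}\right\rceil-1 .$$ -/

import Mathlib

/-- A *unicyclic* graph: a connected graph containing exactly one cycle, where cycles are counted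
as subgraphs (so that closed walks differing only in base point or orientation are one cycle). -/
def IsUnicyclic {V : Type*} (G : SimpleGraph V) : Prop :=
  G.Connected ∧
    ∃! H : G.Subgraph, ∃ (v : V) (w : G.Walk v v), w.IsCycle ∧ w.toSubgraph = H

/-- The number of Laplacian eigenvalues of `G`, counted with multiplicity, lying in `I`.
`Matrix.IsHermitian.eigenvalues` lists all eigenvalues of the matrix with multiplicity. -/
noncomputable def numLaplacianEigenvalues {V : Type*} [Fintype V] [DecidableEq V]
    (G : SimpleGraph V) [DecidableRel G.Adj] (I : Set ℝ) : ℕ :=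
  {i : V | (G.isHermitian_lapMatrix ℝ).eigenvalues i ∈ I}.ncard

/-! By the Rayleigh principle it is enough to find a space of the required dimension on which `xᵀ L
x - xᵀ x` is negative definite. A unicyclic graph has at most as many edges as vertices, so the
space may be built on a subgraph: forcing a vector to be constant along every unused edge costs at
most as many dimensions as the unused vertices supply, plus one for each vertex without a parent
(`finrank_le_numLaplacianEigenvalues`).

The subgraph is the cycle together with a diametral path. If they meet, only the parts of the path
before its first and after its last meeting with the cycle are kept, as two tails of `p` and `q`
edges at cycle distance `a`; then `d ≤ p + a + q`. If they are disjoint, the path keeps a root,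
which costs one dimension.

At eigenvalue 1 the Laplacian recurrence along a path is `X (i+2) = X (i+1) - X i`, so `X (i+3) = -X
i`. Perturbing such a solution gives one independent negative direction for every three edges
(`HasChain.add_three`). A long chain thus reduces to one of at most three edges, leaving a quadratic
form in its end values. The cycle splits at the junctions into arcs of `a` and `b = r - a` edges.
With `2 * a ≤ r`, the longer arc supplies the `r / 6` term; the shorter arc and the tails supply the
`d / 3` term. Rounding losses modulo 3 are recovered from the form in the two junction values. -/

/-! ### Eigenvalues below 1 and negative definite spaces -/

open Matrix in
theorem Matrix.IsHermitian.dotProduct_mulVec_eq_sum_eigenvalues {n : Type*} [Fintype n]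
    [DecidableEq n] {M : Matrix n n ℝ} (hM : M.IsHermitian) (x : n → ℝ) :
    x ⬝ᵥ (M *ᵥ x) =
      ∑ i, hM.eigenvalues i * (inner ℝ (hM.eigenvectorBasis i) (WithLp.toLp 2 x)) ^ 2 := by
  have h1 := hM.eigenvectorBasis.sum_inner_mul_inner (WithLp.toLp 2 x) (WithLp.toLp 2 (M *ᵥ x))
  have h2 : inner ℝ (WithLp.toLp 2 x) (WithLp.toLp 2 (M *ᵥ x)) = x ⬝ᵥ (M *ᵥ x) := by
    simp [PiLp.inner_apply, dotProduct, mul_comm]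
  rw [← h2, ← h1]
  refine Finset.sum_congr rfl fun i _ => ?_
  have h3 : inner ℝ (hM.eigenvectorBasis i) (WithLp.toLp 2 (M *ᵥ x)) =
      hM.eigenvalues i * inner ℝ (hM.eigenvectorBasis i) (WithLp.toLp 2 x) := by
    have e1 : ∀ y : n → ℝ, inner ℝ (hM.eigenvectorBasis i) (WithLp.toLp 2 y) =
        (hM.eigenvectorBasis i : n → ℝ) ⬝ᵥ y := fun y => by
      simp [PiLp.inner_apply, dotProduct, mul_comm]
    rw [e1, e1, dotProduct_mulVec, ← mulVec_transpose]
    have ht : Mᵀ = M := by simpa [conjTranspose] using hM.eq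
    rw [ht, hM.mulVec_eigenvectorBasis]
    simp
  rw [h3, real_inner_comm]
  ring

open Matrix in
/-- A space of vectors on which the form `xᵀ M x - xᵀ x` is negative definite has at most as many
dimensions as `M` has eigenvalues below `1`. -/
theorem Matrix.IsHermitian.finrank_le_ncard_eigenvalues_lt_one {n A : Type*} [Fintype n]
    [DecidableEq n] [AddCommGroup A] [Module ℝ A] {M : Matrix n n ℝ} (hM : M.IsHermitian)
    (Φ : A →ₗ[ℝ] (n → ℝ)) (hΦ : ∀ a, a ≠ 0 → Φ a ⬝ᵥ (M *ᵥ Φ a) < Φ a ⬝ᵥ Φ a) :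
    Module.finrank ℝ A ≤ {i | hM.eigenvalues i < 1}.ncard := by
  classical
  let b := hM.eigenvectorBasis
  let T : A →ₗ[ℝ] ({i // hM.eigenvalues i < 1} → ℝ) :=
    { toFun := fun a i => inner ℝ (b i) (WithLp.toLp 2 (Φ a))
      map_add' := fun a a' => by ext i; simp [inner_add_right]
      map_smul' := fun r a => by ext i; simp [inner_smul_right] }
  -- A vector orthogonal to every eigenvector with eigenvalue below 1 has Rayleigh quotient at least
  -- 1 (or vanishes), against `hΦ`.
  have hT : Function.Injective T := by
    rw [← LinearMap.ker_eq_bot, LinearMap.ker_eq_bot']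
    intro a ha
    by_contra hne
    have h1 := hΦ a hne
    rw [hM.dotProduct_mulVec_eq_sum_eigenvalues] at h1
    have h2 : Φ a ⬝ᵥ Φ a = ∑ i, (inner ℝ (b i) (WithLp.toLp 2 (Φ a))) ^ 2 := by
      have := b.sum_inner_mul_inner (WithLp.toLp 2 (Φ a)) (WithLp.toLp 2 (Φ a))
      have h3 : inner ℝ (WithLp.toLp 2 (Φ a)) (WithLp.toLp 2 (Φ a)) = Φ a ⬝ᵥ Φ a := by
        rw [PiLp.inner_apply]
        simp [dotProduct, pow_two]
      rw [← h3, ← this]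
      refine Finset.sum_congr rfl fun i _ => ?_
      rw [real_inner_comm]
      ring
    rw [h2] at h1
    refine absurd h1 (not_lt.mpr (Finset.sum_le_sum fun i _ => ?_))
    by_cases hi : hM.eigenvalues i < 1
    · have : inner ℝ (b i) (WithLp.toLp 2 (Φ a)) = 0 := congrFun ha ⟨i, hi⟩
      change _ ≤ hM.eigenvalues i * (inner ℝ (b i) (WithLp.toLp 2 (Φ a))) ^ 2
      rw [this]
      simp
    · exact le_mul_of_one_le_left (sq_nonneg _) (not_lt.mp hi)
  have h := LinearMap.finrank_le_finrank_of_injective hT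
  rw [Module.finrank_fintype_fun_eq_card] at h
  rwa [← Nat.card_coe_set_eq, Nat.card_eq_fintype_card]

/-! ### The Laplacian form on edges, and transfer from a subgraph -/

/-- The squared difference of a vertex function along an edge. -/
def edgeSq {V : Type*} (x : V → ℝ) : Sym2 V → ℝ :=
  Sym2.lift ⟨fun u v => (x u - x v) ^ 2, fun u v => by ring⟩

@[simp]
theorem edgeSq_mk {V : Type*} (x : V → ℝ) (u v : V) : edgeSq x s(u, v) = (x u - x v) ^ 2 := rfl

namespace SimpleGraph

variable {V : Type*} [Fintype V] [DecidableEq V] (G : SimpleGraph V) [DecidableRel G.Adj]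

theorem dotProduct_lapMatrix_mulVec (x : V → ℝ) :
    x ⬝ᵥ (G.lapMatrix ℝ).mulVec x = ∑ e ∈ G.edgeFinset, edgeSq x e := by
  rw [← Matrix.toLinearMap₂'_apply', lapMatrix_toLinearMap₂']
  have h1 : ∑ i, ∑ j, (if G.Adj i j then (x i - x j) ^ 2 else 0) =
      ∑ d : G.Dart, edgeSq x d.edge := by
    rw [← Fintype.sum_prod_type' (f := fun i j => if G.Adj i j then (x i - x j) ^ 2 else 0),
      ← Finset.sum_filter]
    symm
    refine Finset.sum_bij (fun d _ => d.toProd) (fun d _ => ?_) (fun d _ d' _ h => ?_)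
      (fun p hp => ?_) (fun d _ => ?_)
    · simp [d.adj]
    · exact Dart.ext _ _ h
    · exact ⟨⟨p, by simpa using hp⟩, Finset.mem_univ _, rfl⟩
    · rfl
  have h2 : ∑ d : G.Dart, edgeSq x d.edge = ∑ e ∈ G.edgeFinset, 2 * edgeSq x e := by
    rw [← Finset.sum_fiberwise_of_maps_to (s := Finset.univ) (t := G.edgeFinset)
      (g := fun d : G.Dart => d.edge) (fun d _ => by simp [d.edge_mem])]
    refine Finset.sum_congr rfl fun e he => ?_
    rw [Finset.sum_congr rfl (g := fun _ => edgeSq x e)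
      (fun d hd => by rw [(Finset.mem_filter.mp hd).2]), Finset.sum_const,
      G.dart_edge_fiber_card e (by simpa using he)]
    simp
  rw [h1, h2, ← Finset.mul_sum]
  ring

theorem numLaplacianEigenvalues_Ico :
    numLaplacianEigenvalues G (Set.Ico (0 : ℝ) 1) =
      {i | (G.isHermitian_lapMatrix ℝ).eigenvalues i < 1}.ncard := by
  unfold numLaplacianEigenvalues
  congr 1
  ext i
  simpa using fun _ => (posSemidef_lapMatrix ℝ G).eigenvalues_nonneg i

/-- Lower bound for the number of small Laplacian eigenvalues of a graph with at most as many edges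
as vertices, from a subgraph given by an injective vertex map `ν` and a parent map `f`, the vertices
without a parent being those fixed by `f`. -/
theorem finrank_le_numLaplacianEigenvalues (hE : G.edgeFinset.card ≤ Fintype.card V)
    {I A : Type*} [Fintype I] [DecidableEq I] [AddCommGroup A] [Module ℝ A] [FiniteDimensional ℝ A]
    (ν : I → V) (hν : Function.Injective ν) (f : I → I)
    (hadj : ∀ i, f i ≠ i → G.Adj (ν i) (ν (f i))) (hff : ∀ i, f i ≠ i → f (f i) ≠ i)
    (Φ : A →ₗ[ℝ] (I → ℝ))
    (hneg : ∀ a, a ≠ 0 → ∑ i, ((Φ a i - Φ a (f i)) ^ 2 - Φ a i ^ 2) < 0) :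
    Module.finrank ℝ A ≤
      numLaplacianEigenvalues G (Set.Ico (0 : ℝ) 1) + Fintype.card {i // f i = i} := by
  rw [numLaplacianEigenvalues_Ico]
  set J : Finset I := Finset.univ.filter fun i => f i ≠ i with hJ
  set E₁ : Finset (Sym2 V) := J.image fun i => s(ν i, ν (f i)) with hE₁
  -- No two vertices are each other's parent, by `hff`, so each parent edge arises from one child
  -- only.
  have hinj : Set.InjOn (fun i => s(ν i, ν (f i))) (J : Set I) := by
    intro i hi j hj hij
    simp only [hJ, Finset.coe_filter, Finset.mem_univ, true_and, Set.mem_ofPred_eq] at hi hj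
    rcases Sym2.eq_iff.mp hij with h | h
    · exact hν h.1
    · have h1 := hν h.1
      have h2 := hν h.2
      exact absurd (by rw [h2, ← h1]) (hff i hi)
  have hsub : E₁ ⊆ G.edgeFinset := by
    intro e he
    obtain ⟨i, hi, rfl⟩ := Finset.mem_image.mp he
    simpa using hadj i (by simpa [hJ] using hi)
  have hcard : E₁.card + Fintype.card {i // f i = i} = Fintype.card I := by
    rw [hE₁, Finset.card_image_of_injOn hinj, Fintype.card_subtype, hJ, add_comm,
      Finset.card_filter_add_card_filter_not]
    rfl
  let E₂ := G.edgeFinset \ E₁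
  have hE₂ : E₂.card + E₁.card = G.edgeFinset.card := Finset.card_sdiff_add_card_eq_card hsub
  have hIV : Fintype.card I ≤ Fintype.card V := Fintype.card_le_of_injective ν hν
  -- The kernel consists of pairs `(a, x)` where `x` extends `Φ a` and is constant along each edge
  -- outside the subgraph. Since `|E₂| = |E| - |I| + #roots` and `|E| ≤ |V|`, its dimension is at
  -- least `finrank A - #roots`.
  let K : A × (V → ℝ) →ₗ[ℝ] (I → ℝ) × (E₂ → ℝ) :=
    { toFun := fun p => (fun i => p.2 (ν i) - Φ p.1 i,
        fun e => p.2 (Quot.out e.1).1 - p.2 (Quot.out e.1).2)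
      map_add' := fun p p' => by
        ext i <;> simp <;> ring
      map_smul' := fun r p => by
        ext i <;> simp <;> ring }
  have hrank := LinearMap.finrank_range_add_finrank_ker K
  have hrange : Module.finrank ℝ (LinearMap.range K) ≤ Fintype.card I + E₂.card := by
    refine (Submodule.finrank_le _).trans ?_
    simp
  rw [Module.finrank_prod, Module.finrank_fintype_fun_eq_card] at hrank
  have hmain := (G.isHermitian_lapMatrix ℝ).finrank_le_ncard_eigenvalues_lt_one
    ((LinearMap.snd ℝ A (V → ℝ)).comp (LinearMap.ker K).subtype) ?_
  · omega
  rintro ⟨⟨a, x⟩, hax⟩ hne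
  have hK : K (a, x) = 0 := hax
  have h1 : ∀ i, x (ν i) = Φ a i := fun i => sub_eq_zero.mp (congrFun (congrArg Prod.fst hK) i)
  have h2 : ∀ e ∈ E₂, edgeSq x e = 0 := by
    intro e he
    have h3 : x (Quot.out e).1 - x (Quot.out e).2 = 0 :=
      congrFun (congrArg Prod.snd hK) ⟨e, he⟩
    have h4 : e = s((Quot.out e).1, (Quot.out e).2) := (Quot.out_eq e).symm
    rw [h4, edgeSq_mk, h3]
    simp
  change x ⬝ᵥ (G.lapMatrix ℝ).mulVec x < x ⬝ᵥ x
  rw [dotProduct_lapMatrix_mulVec, ← Finset.sum_sdiff hsub, Finset.sum_eq_zero h2, zero_add, hE₁,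
    Finset.sum_image hinj]
  have h5 : ∑ i ∈ J, edgeSq x s(ν i, ν (f i)) = ∑ i, (Φ a i - Φ a (f i)) ^ 2 := by
    rw [hJ, Finset.sum_filter]
    refine Finset.sum_congr rfl fun i _ => ?_
    split_ifs with h
    · rw [edgeSq_mk, h1, h1]
    · rw [not_not.mp h]
      simp
  have h6 : ∑ i, Φ a i ^ 2 ≤ x ⬝ᵥ x := by
    have : ∑ i, Φ a i ^ 2 = ∑ v ∈ Finset.univ.image ν, x v ^ 2 := by
      rw [Finset.sum_image fun i _ j _ h => hν h]
      simp [h1]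
    rw [this, dotProduct]
    simp only [← pow_two]
    exact Finset.sum_le_sum_of_subset_of_nonneg (Finset.subset_univ _) fun _ _ _ => sq_nonneg _
  rw [h5]
  -- If `a = 0`, all edge terms vanish and only `-xᵀ x` remains, with `x ≠ 0`.
  by_cases ha : a = 0
  · have hx : x ≠ 0 := by
      rintro rfl
      exact hne (by ext1; simp [ha])
    have : ∑ i, (Φ a i - Φ a (f i)) ^ 2 = 0 := by simp [ha]
    rw [this]
    have h7 : 0 ≤ x ⬝ᵥ x := Finset.sum_nonneg fun i _ => mul_self_nonneg _
    exact lt_of_le_of_ne h7 fun h => hx (dotProduct_self_eq_zero.mp h.symm)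
  · have := hneg a ha
    rw [Finset.sum_sub_distrib] at this
    linarith

end SimpleGraph

/-! ### Negative directions along a path -/

/-- The part of the form `xᵀ L x - xᵀ x` that comes from a path of `n` edges, its starting vertex
not counted. -/
def chainEnergy (X : ℕ → ℝ) (n : ℕ) : ℝ :=
  ∑ i ∈ Finset.range n, ((X (i + 1) - X i) ^ 2 - X (i + 1) ^ 2)

theorem chainEnergy_succ (X : ℕ → ℝ) (n : ℕ) :
    chainEnergy X (n + 1) = chainEnergy X n + ((X (n + 1) - X n) ^ 2 - X (n + 1) ^ 2) :=
  Finset.sum_range_succ _ _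

theorem chainEnergy_succ' (X : ℕ → ℝ) (n : ℕ) :
    chainEnergy X (n + 1) =
      chainEnergy (fun i => X (i + 1)) n + ((X 1 - X 0) ^ 2 - X 1 ^ 2) :=
  Finset.sum_range_succ' _ _

@[simp]
theorem chainEnergy_zero (X : ℕ → ℝ) : chainEnergy X 0 = 0 := rfl

/-- There is a linear family of functions on a path of `n` edges, with prescribed value `x` at the
start, last value related to `y` by `R`, and `k` further parameters, whose energy is at most
`α x² + β x y + γ y²`, and smaller when the further parameters are not all zero. -/
def HasChain (R : ℝ → ℝ → Prop) (n k : ℕ) (α β γ : ℝ) : Prop :=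
  ∃ Φ : ((ℝ × ℝ) × (Fin k → ℝ)) →ₗ[ℝ] (ℕ → ℝ), ∀ x y c,
    Φ ((x, y), c) 0 = x ∧ R (Φ ((x, y), c) n) y ∧
    chainEnergy (Φ ((x, y), c)) n ≤ α * x ^ 2 + β * x * y + γ * y ^ 2 ∧
    (c ≠ 0 → chainEnergy (Φ ((x, y), c)) n < α * x ^ 2 + β * x * y + γ * y ^ 2)

/-- The prefix `x, x + z, z` followed by `c 0 - x` has energy exactly `-2 * z * c 0`. For `c 0 = 0`
it solves the eigenvalue-1 recurrence and merely replaces `x` by `-x`, whence the sign change of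
`β`. -/
theorem HasChain.add_three {R : ℝ → ℝ → Prop} {n k : ℕ} {α β γ : ℝ} (h : HasChain R n k α β γ) :
    HasChain R (n + 3) (k + 1) α (-β) γ := by
  obtain ⟨Φ, hΦ⟩ := h
  -- The second summand cancels the cross terms of `c 0` with `x` and `y`; the first leaves `-(2 *
  -- |α| - α + 2) * c 0 ^ 2`, negative whatever the sign of `α`.
  let z : ((ℝ × ℝ) × (Fin (k + 1) → ℝ)) → ℝ :=
    fun p => (|α| + 1) * p.2 0 + (-2 * α * p.1.1 + β * p.1.2) / 2
  let o : ((ℝ × ℝ) × (Fin (k + 1) → ℝ)) → ((ℝ × ℝ) × (Fin k → ℝ)) :=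
    fun p => ((p.2 0 - p.1.1, p.1.2), Fin.tail p.2)
  have hoadd : ∀ p p', o (p + p') = o p + o p' := fun p p' => by
    simp only [o]
    refine Prod.ext (Prod.ext ?_ ?_) ?_
    · simp; ring
    · simp
    · rfl
  have hosmul : ∀ (r : ℝ) p, o (r • p) = r • o p := fun r p => by
    simp only [o]
    refine Prod.ext (Prod.ext ?_ ?_) ?_
    · simp; ring
    · simp
    · rfl
  let Ψ : ((ℝ × ℝ) × (Fin (k + 1) → ℝ)) →ₗ[ℝ] (ℕ → ℝ) :=
    { toFun := fun p i => match i with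
        | 0 => p.1.1
        | 1 => p.1.1 + z p
        | 2 => z p
        | (i + 3) => Φ (o p) i
      map_add' := fun p p' => by
        ext i
        rcases i with _ | _ | _ | i
        · simp
        · simp [z]; ring
        · simp [z]; ring
        · simp [hoadd]
      map_smul' := fun r p => by
        ext i
        rcases i with _ | _ | _ | i
        · simp
        · simp [z]; ring
        · simp [z]; ring
        · simp [hosmul] }
  refine ⟨Ψ, fun x y c => ?_⟩
  obtain ⟨h0, hR, hle, hlt⟩ := hΦ (c 0 - x) y (Fin.tail c)
  have hE : chainEnergy (Ψ ((x, y), c)) (n + 3) =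
      chainEnergy (Φ ((c 0 - x, y), Fin.tail c)) n
        - 2 * ((|α| + 1) * c 0 + (-2 * α * x + β * y) / 2) * c 0 := by
    rw [chainEnergy_succ', chainEnergy_succ', chainEnergy_succ']
    have e3 : Ψ ((x, y), c) 3 = c 0 - x := h0
    have e2 : Ψ ((x, y), c) 2 = (|α| + 1) * c 0 + (-2 * α * x + β * y) / 2 := rfl
    have e1 : Ψ ((x, y), c) 1 = x + ((|α| + 1) * c 0 + (-2 * α * x + β * y) / 2) := rfl
    have e0 : Ψ ((x, y), c) 0 = x := rfl
    have er : (fun i => Ψ ((x, y), c) (i + 1 + 1 + 1)) = Φ ((c 0 - x, y), Fin.tail c) := rfl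
    norm_num only [zero_add]
    rw [er, e3, e2, e1, e0]
    ring
  have habs := le_abs_self α
  have key : α * (c 0 - x) ^ 2 + β * (c 0 - x) * y + γ * y ^ 2
      - 2 * ((|α| + 1) * c 0 + (-2 * α * x + β * y) / 2) * c 0 =
      α * x ^ 2 + -β * x * y + γ * y ^ 2 - (2 * |α| - α + 2) * c 0 ^ 2 := by ring
  have hpos : 0 < 2 * |α| - α + 2 := by
    have := abs_nonneg α
    linarith
  refine ⟨rfl, hR, ?_, fun hc => ?_⟩
  · rw [hE]
    have := mul_nonneg hpos.le (sq_nonneg (c 0))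
    linarith
  · rw [hE]
    by_cases ht : Fin.tail c = 0
    · have hc0 : c 0 ≠ 0 := by
        intro h0
        refine hc (funext fun i => ?_)
        refine Fin.cases h0 (fun j => congrFun ht j) i
      have := mul_pos hpos (pow_pos (abs_pos.mpr hc0) 2)
      rw [sq_abs] at this
      linarith
    · have := mul_nonneg hpos.le (sq_nonneg (c 0))
      have := hlt ht
      linarith

theorem HasChain.add_three_mul {R : ℝ → ℝ → Prop} {n k : ℕ} {α β γ : ℝ}
    (h : HasChain R n k α β γ) (m : ℕ) :
    HasChain R (3 * m + n) (m + k) α ((-1) ^ m * β) γ := by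
  induction m with
  | zero => simpa using h
  | succ m ih =>
    have := ih.add_three
    rw [show 3 * m + n + 3 = 3 * (m + 1) + n by ring, show m + k + 1 = m + 1 + k by ring] at this
    rwa [pow_succ, mul_neg_one, neg_mul]

/-- Chains with a free end, such as pendant paths. -/
abbrev HasTail (p k : ℕ) (τ : ℝ) : Prop := HasChain (fun _ _ => True) p k τ 0 0

/-- Chains with both ends prescribed, such as arcs of a cycle. -/
abbrev HasArc (n k : ℕ) (α β γ : ℝ) : Prop := HasChain Eq n k α β γ

theorem hasTail_zero : HasTail 0 0 0 := by
  refine ⟨LinearMap.pi fun _ => (LinearMap.fst ℝ ℝ ℝ).comp (LinearMap.fst ℝ (ℝ × ℝ) (Fin 0 → ℝ)),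
    fun x y c => ⟨rfl, trivial, by simp, fun hc => absurd (Subsingleton.elim c 0) hc⟩⟩

/-- The free end value enters linearly, as `x ^ 2 - 2 * X 1 * x`, so it can make the energy as
negative as desired. Tails of length 1 modulo 3 inherit this freedom. -/
theorem hasTail_one (N : ℝ) : HasTail 1 0 (-N) := by
  let x : ((ℝ × ℝ) × (Fin 0 → ℝ)) →ₗ[ℝ] ℝ :=
    (LinearMap.fst ℝ ℝ ℝ).comp (LinearMap.fst ℝ (ℝ × ℝ) (Fin 0 → ℝ))
  refine ⟨LinearMap.pi fun i => if i = 0 then x else ((N + 1) / 2) • x,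
    fun a b c => ⟨rfl, trivial, le_of_eq ?_, fun hc => absurd (Subsingleton.elim c 0) hc⟩⟩
  simp [chainEnergy_succ, LinearMap.pi_apply, x]
  ring

theorem hasTail_two : HasTail 2 1 1 := by
  let x : ((ℝ × ℝ) × (Fin 1 → ℝ)) →ₗ[ℝ] ℝ :=
    (LinearMap.fst ℝ ℝ ℝ).comp (LinearMap.fst ℝ (ℝ × ℝ) (Fin 1 → ℝ))
  let c : ((ℝ × ℝ) × (Fin 1 → ℝ)) →ₗ[ℝ] ℝ :=
    (LinearMap.proj 0).comp (LinearMap.snd ℝ (ℝ × ℝ) (Fin 1 → ℝ))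
  let Φ : ((ℝ × ℝ) × (Fin 1 → ℝ)) →ₗ[ℝ] (ℕ → ℝ) :=
    LinearMap.pi fun i => if i = 0 then x else if i = 1 then c else c - x
  have hE : ∀ (a b : ℝ) (d : Fin 1 → ℝ), chainEnergy (Φ ((a, b), d)) 2 = a ^ 2 - d 0 ^ 2 := by
    intro a b d
    simp [chainEnergy_succ, LinearMap.pi_apply, Φ, x, c]
  refine ⟨Φ, fun a b d => ⟨rfl, trivial, ?_, fun hd => ?_⟩⟩
  · rw [hE]
    nlinarith [sq_nonneg (d 0)]
  · rw [hE]
    have : d 0 ≠ 0 := fun h => hd (funext fun i => by rwa [Subsingleton.elim i 0])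
    have := pow_pos (abs_pos.mpr this) 2
    rw [sq_abs] at this
    linarith

theorem hasArc_one : HasArc 1 0 1 (-2) 0 := by
  let x : ((ℝ × ℝ) × (Fin 0 → ℝ)) →ₗ[ℝ] ℝ :=
    (LinearMap.fst ℝ ℝ ℝ).comp (LinearMap.fst ℝ (ℝ × ℝ) (Fin 0 → ℝ))
  let y : ((ℝ × ℝ) × (Fin 0 → ℝ)) →ₗ[ℝ] ℝ :=
    (LinearMap.snd ℝ ℝ ℝ).comp (LinearMap.fst ℝ (ℝ × ℝ) (Fin 0 → ℝ))
  refine ⟨LinearMap.pi fun i => if i = 0 then x else y,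
    fun a b c => ⟨rfl, rfl, le_of_eq ?_, fun hc => absurd (Subsingleton.elim c 0) hc⟩⟩
  simp [chainEnergy_succ, LinearMap.pi_apply, x, y]
  ring

theorem hasArc_two : HasArc 2 0 0 (-2) (-1) := by
  let x : ((ℝ × ℝ) × (Fin 0 → ℝ)) →ₗ[ℝ] ℝ :=
    (LinearMap.fst ℝ ℝ ℝ).comp (LinearMap.fst ℝ (ℝ × ℝ) (Fin 0 → ℝ))
  let y : ((ℝ × ℝ) × (Fin 0 → ℝ)) →ₗ[ℝ] ℝ :=
    (LinearMap.snd ℝ ℝ ℝ).comp (LinearMap.fst ℝ (ℝ × ℝ) (Fin 0 → ℝ))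
  refine ⟨LinearMap.pi fun i => if i = 0 then x else if i = 1 then x + y else y,
    fun a b c => ⟨rfl, rfl, le_of_eq ?_, fun hc => absurd (Subsingleton.elim c 0) hc⟩⟩
  simp [chainEnergy_succ, LinearMap.pi_apply, x, y]
  ring

/-- The interior value `t * (x + y)`, taken twice, gives energy `x ^ 2 - 2 * t * (x + y) ^ 2`,
arbitrarily negative off the line `x + y = 0`. After `m` extensions by three edges that line becomes
`x + (-1) ^ m * y = 0`. -/
theorem hasArc_three (t : ℝ) : HasArc 3 0 (1 - 2 * t) (-4 * t) (-2 * t) := by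
  let x : ((ℝ × ℝ) × (Fin 0 → ℝ)) →ₗ[ℝ] ℝ :=
    (LinearMap.fst ℝ ℝ ℝ).comp (LinearMap.fst ℝ (ℝ × ℝ) (Fin 0 → ℝ))
  let y : ((ℝ × ℝ) × (Fin 0 → ℝ)) →ₗ[ℝ] ℝ :=
    (LinearMap.snd ℝ ℝ ℝ).comp (LinearMap.fst ℝ (ℝ × ℝ) (Fin 0 → ℝ))
  refine ⟨LinearMap.pi fun i => if i = 0 then x else if i = 1 then t • (x + y) else
    if i = 2 then t • (x + y) else y,
    fun a b c => ⟨rfl, rfl, le_of_eq ?_, fun hc => absurd (Subsingleton.elim c 0) hc⟩⟩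
  simp [chainEnergy_succ, LinearMap.pi_apply, x, y]
  ring

theorem hasTail_of_mod_eq_zero {p : ℕ} (hp : p % 3 = 0) : HasTail p ((p + 1) / 3) 0 := by
  have := hasTail_zero.add_three_mul (p / 3)
  rw [mul_zero] at this
  rwa [show (p + 1) / 3 = p / 3 + 0 by omega, show p = 3 * (p / 3) + 0 by omega,
    show (3 * (p / 3) + 0) / 3 = p / 3 by omega]

theorem hasTail_of_mod_eq_one {p : ℕ} (hp : p % 3 = 1) (N : ℝ) : HasTail p ((p + 1) / 3) (-N) := by
  have := (hasTail_one N).add_three_mul (p / 3)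
  rwa [mul_zero, show 3 * (p / 3) + 1 = p by omega, show p / 3 + 0 = (p + 1) / 3 by omega] at this

theorem hasTail_of_mod_eq_two {p : ℕ} (hp : p % 3 = 2) : HasTail p ((p + 1) / 3) 1 := by
  have := hasTail_two.add_three_mul (p / 3)
  rwa [mul_zero, show 3 * (p / 3) + 2 = p by omega, show p / 3 + 1 = (p + 1) / 3 by omega] at this

theorem exists_hasTail (p : ℕ) : ∃ τ, HasTail p ((p + 1) / 3) τ := by
  obtain h | h | h : p % 3 = 0 ∨ p % 3 = 1 ∨ p % 3 = 2 := by omega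
  · exact ⟨_, hasTail_of_mod_eq_zero h⟩
  · exact ⟨_, hasTail_of_mod_eq_one h 0⟩
  · exact ⟨_, hasTail_of_mod_eq_two h⟩

theorem hasArc_of_mod_eq_one {n : ℕ} (hn : n % 3 = 1) :
    HasArc n ((n + 2) / 3 - 1) 1 ((-1) ^ ((n + 2) / 3 - 1) * -2) 0 := by
  have := hasArc_one.add_three_mul (n / 3)
  rwa [show 3 * (n / 3) + 1 = n by omega, add_zero,
    show n / 3 = (n + 2) / 3 - 1 by omega] at this

theorem hasArc_of_mod_eq_two {n : ℕ} (hn : n % 3 = 2) :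
    HasArc n ((n + 2) / 3 - 1) 0 ((-1) ^ ((n + 2) / 3 - 1) * -2) (-1) := by
  have := hasArc_two.add_three_mul (n / 3)
  rwa [show 3 * (n / 3) + 2 = n by omega, add_zero,
    show n / 3 = (n + 2) / 3 - 1 by omega] at this

theorem hasArc_of_mod_eq_zero {n : ℕ} (hn : n % 3 = 0) (hpos : 0 < n) (t : ℝ) :
    HasArc n ((n + 2) / 3 - 1) (1 - 2 * t) ((-1) ^ ((n + 2) / 3 - 1) * (-4 * t)) (-2 * t) := by
  have := (hasArc_three t).add_three_mul (n / 3 - 1)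
  rwa [show 3 * (n / 3 - 1) + 3 = n by omega, add_zero,
    show n / 3 - 1 = (n + 2) / 3 - 1 by omega] at this

theorem exists_hasArc {n : ℕ} (hpos : 0 < n) : ∃ α β γ, HasArc n ((n + 2) / 3 - 1) α β γ := by
  obtain h | h | h : n % 3 = 0 ∨ n % 3 = 1 ∨ n % 3 = 2 := by omega
  · exact ⟨_, _, _, hasArc_of_mod_eq_zero h hpos 0⟩
  · exact ⟨_, _, _, hasArc_of_mod_eq_one h⟩
  · exact ⟨_, _, _, hasArc_of_mod_eq_two h⟩

/-! ### The two configurations inside the graph -/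

/-- `M` bounds the dimension of every space of functions, negative for the form `xᵀ L x - xᵀ x`, on
a cycle of length `r` with pendant paths of `p` and `q` edges at two vertices at distance `a` along
the cycle. -/
def BoundsCycleTwoTails (r p q a M : ℕ) : Prop :=
  ∀ (A : Type) [AddCommGroup A] [Module ℝ A] [FiniteDimensional ℝ A] (C S T : A →ₗ[ℝ] (ℕ → ℝ)),
    (∀ w, C w r = C w 0) → (∀ w, S w 0 = C w 0) → (∀ w, T w 0 = C w a) →
    (∀ w, w ≠ 0 → chainEnergy (C w) r + chainEnergy (S w) p + chainEnergy (T w) q < 0) →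
    Module.finrank ℝ A ≤ M

/-- `M + 1` bounds the dimension of every space of functions, negative for the form
`xᵀ L x - xᵀ x`, on the disjoint union of a cycle of length `r` and a path of `d` edges. -/
def BoundsCyclePath (r d M : ℕ) : Prop :=
  ∀ (A : Type) [AddCommGroup A] [Module ℝ A] [FiniteDimensional ℝ A] (C T : A →ₗ[ℝ] (ℕ → ℝ)),
    (∀ w, C w r = C w 0) →
    (∀ w, w ≠ 0 → chainEnergy (C w) r + chainEnergy (T w) d - T w 0 ^ 2 < 0) →
    Module.finrank ℝ A ≤ M + 1

theorem ZMod.sum_val_eq_sum_range {r : ℕ} [NeZero r] (g : ℕ → ℝ) :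
    ∑ i : ZMod r, g i.val = ∑ i ∈ Finset.range r, g i := by
  obtain ⟨n, rfl⟩ := Nat.exists_eq_succ_of_ne_zero (NeZero.ne r)
  exact Fin.sum_univ_eq_sum_range g (n + 1)

theorem ZMod.apply_val_add_one {β : Type*} {r : ℕ} [NeZero r] (hr : 1 < r) {X : ℕ → β} (hX : X r = X 0)
    (i : ZMod r) : X (i + 1).val = X (i.val + 1) := by
  have : Fact (1 < r) := ⟨hr⟩
  have hlt := i.val_lt
  rw [ZMod.val_add, ZMod.val_one]
  rcases Nat.lt_or_ge (i.val + 1) r with h | h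
  · rw [Nat.mod_eq_of_lt h]
  · rw [show i.val + 1 = r by omega, Nat.mod_self, hX]

/-- The squares are attached to the start of each edge on one side and to its end on the other;
around a closed cycle the totals agree. -/
theorem ZMod.sum_cycle_eq_chainEnergy {r : ℕ} [NeZero r] (hr : 1 < r) {X : ℕ → ℝ}
    (hX : X r = X 0) :
    ∑ i : ZMod r, ((X i.val - X (i + 1).val) ^ 2 - X i.val ^ 2) = chainEnergy X r := by
  simp_rw [ZMod.apply_val_add_one hr hX]
  rw [ZMod.sum_val_eq_sum_range fun i => (X i - X (i + 1)) ^ 2 - X i ^ 2, chainEnergy,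
    Finset.sum_sub_distrib, Finset.sum_sub_distrib]
  have h1 := Finset.sum_range_succ (fun i => X i ^ 2) r
  have h2 := Finset.sum_range_succ' (fun i => X i ^ 2) r
  have h3 : ∑ i ∈ Finset.range r, (X i - X (i + 1)) ^ 2 =
      ∑ i ∈ Finset.range r, (X (i + 1) - X i) ^ 2 :=
    Finset.sum_congr rfl fun i _ => by ring
  rw [hX] at h1
  rw [h3]
  linarith

theorem ZMod.add_one_add_one_ne_self {r : ℕ} (hr : 3 ≤ r) (i : ZMod r) : i + 1 + 1 ≠ i := by
  intro h
  have h2 : ((2 : ℕ) : ZMod r) = 0 := by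
    push_cast
    linear_combination h
  rw [ZMod.natCast_eq_zero_iff] at h2
  exact absurd (Nat.le_of_dvd two_pos h2) (by omega)

theorem ZMod.add_one_ne_self {r : ℕ} (hr : 3 ≤ r) (i : ZMod r) : i + 1 ≠ i := by
  intro h
  exact ZMod.add_one_add_one_ne_self hr i (by rw [h, h])

namespace SimpleGraph

variable {V : Type*} [Fintype V] [DecidableEq V] (G : SimpleGraph V) [DecidableRel G.Adj]

theorem boundsCycleTwoTails (hE : G.edgeFinset.card ≤ Fintype.card V) {r p q a : ℕ} (hr : 3 ≤ r)
    (ha : a < r) (c : ZMod r → V) (s t : ℕ → V)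
    (hinj : Function.Injective
      (Sum.elim c (Sum.elim (fun i : Fin p => s (i + 1)) (fun i : Fin q => t (i + 1)))))
    (hc : ∀ i, G.Adj (c i) (c (i + 1))) (hs : ∀ i < p, G.Adj (s i) (s (i + 1)))
    (ht : ∀ i < q, G.Adj (t i) (t (i + 1))) (hs0 : s 0 = c 0) (ht0 : t 0 = c a) :
    BoundsCycleTwoTails r p q a (numLaplacianEigenvalues G (Set.Ico (0 : ℝ) 1)) := by
  intro A _ _ _ C S T hC hS hT hneg
  have : NeZero r := ⟨by omega⟩
  -- Rotation on the cycle, one step towards the cycle on the tails: no vertex is fixed, so no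
  -- dimension is lost.
  let f : ZMod r ⊕ (Fin p ⊕ Fin q) → ZMod r ⊕ (Fin p ⊕ Fin q) := fun x => match x with
    | Sum.inl i => Sum.inl (i + 1)
    | Sum.inr (Sum.inl ⟨0, _⟩) => Sum.inl 0
    | Sum.inr (Sum.inl ⟨i + 1, h⟩) => Sum.inr (Sum.inl ⟨i, by omega⟩)
    | Sum.inr (Sum.inr ⟨0, _⟩) => Sum.inl a
    | Sum.inr (Sum.inr ⟨i + 1, h⟩) => Sum.inr (Sum.inr ⟨i, by omega⟩)
  let Φ : A →ₗ[ℝ] (ZMod r ⊕ (Fin p ⊕ Fin q) → ℝ) :=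
    { toFun := fun w => Sum.elim (fun i => C w i.val)
        (Sum.elim (fun i => S w (i + 1)) (fun i => T w (i + 1)))
      map_add' := fun w w' => by
        ext (i | i | i) <;> simp
      map_smul' := fun x w => by
        ext (i | i | i) <;> simp }
  have hf : ∀ i, f i ≠ i := by
    rintro (i | ⟨_ | i, hi⟩ | ⟨_ | i, hi⟩)
    · simpa [f] using ZMod.add_one_ne_self hr i
    all_goals simp [f]
  have key := G.finrank_le_numLaplacianEigenvalues hE _ hinj f ?_ ?_ Φ ?_
  · have : Fintype.card {i // f i = i} = 0 := by
      rw [Fintype.card_eq_zero_iff]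
      exact ⟨fun i => hf i.1 i.2⟩
    rwa [this, add_zero] at key
  · rintro (i | ⟨_ | i, hi⟩ | ⟨_ | i, hi⟩) -
    · exact hc i
    · simpa [f, ← hs0] using (hs 0 hi).symm
    · exact (hs (i + 1) hi).symm
    · simpa [f, ← ht0] using (ht 0 hi).symm
    · exact (ht (i + 1) hi).symm
  · rintro (i | ⟨_ | i, hi⟩ | ⟨_ | i, hi⟩) -
    · simpa [f] using ZMod.add_one_add_one_ne_self hr i
    · simp [f]
    · rcases i with _ | i
      · simp [f]
      · intro e
        have : i = i + 2 := Fin.val_eq_of_eq (Sum.inl_injective (Sum.inr_injective e))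
        omega
    · simp [f]
    · rcases i with _ | i
      · simp [f]
      · intro e
        have : i = i + 2 := Fin.val_eq_of_eq (Sum.inr_injective (Sum.inr_injective e))
        omega
  · intro w hw
    have hcyc := ZMod.sum_cycle_eq_chainEnergy (by omega) (hC w)
    have htail : ∀ (X : ℕ → ℝ) (n : ℕ), ∑ i : Fin n, ((X (i + 1) - X i) ^ 2 - X (i + 1) ^ 2) =
        chainEnergy X n := fun X n =>
      Fin.sum_univ_eq_sum_range (fun i => (X (i + 1) - X i) ^ 2 - X (i + 1) ^ 2) n
    have e1 : ∀ i : Fin p, Φ w (f (Sum.inr (Sum.inl i))) = S w i := by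
      rintro ⟨_ | i, hi⟩
      · simp [f, Φ, hS]
      · rfl
    have e2 : ∀ i : Fin q, Φ w (f (Sum.inr (Sum.inr i))) = T w i := by
      rintro ⟨_ | i, hi⟩
      · simp [f, Φ, hT, ZMod.val_natCast_of_lt ha]
      · rfl
    rw [Fintype.sum_sum_type, Fintype.sum_sum_type]
    simp_rw [e1, e2]
    refine lt_of_eq_of_lt ?_ (hneg w hw)
    rw [← hcyc, ← htail, ← htail, add_assoc]
    rfl

theorem boundsCyclePath (hE : G.edgeFinset.card ≤ Fintype.card V) {r d : ℕ} (hr : 3 ≤ r)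
    (c : ZMod r → V) (t : ℕ → V)
    (hinj : Function.Injective (Sum.elim c (fun i : Fin (d + 1) => t i)))
    (hc : ∀ i, G.Adj (c i) (c (i + 1))) (ht : ∀ i < d, G.Adj (t i) (t (i + 1))) :
    BoundsCyclePath r d (numLaplacianEigenvalues G (Set.Ico (0 : ℝ) 1)) := by
  intro A _ _ _ C T hC hneg
  have : NeZero r := ⟨by omega⟩
  -- The start of the path is the only fixed vertex; it accounts for the `+ 1` in `BoundsCyclePath`.
  let f : ZMod r ⊕ Fin (d + 1) → ZMod r ⊕ Fin (d + 1) := fun x => match x with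
    | Sum.inl i => Sum.inl (i + 1)
    | Sum.inr ⟨0, _⟩ => Sum.inr 0
    | Sum.inr ⟨i + 1, h⟩ => Sum.inr ⟨i, by omega⟩
  let Φ : A →ₗ[ℝ] (ZMod r ⊕ Fin (d + 1) → ℝ) :=
    { toFun := fun w => Sum.elim (fun i => C w i.val) (fun i => T w i)
      map_add' := fun w w' => by
        ext (i | i) <;> simp
      map_smul' := fun x w => by
        ext (i | i) <;> simp }
  have key := G.finrank_le_numLaplacianEigenvalues hE _ hinj f ?_ ?_ Φ ?_
  · have : Fintype.card {i // f i = i} = 1 := by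
      rw [Fintype.card_eq_one_iff]
      refine ⟨⟨Sum.inr 0, rfl⟩, ?_⟩
      rintro ⟨i | ⟨_ | i, hi⟩, h⟩
      · exact absurd (Sum.inl_injective h) (ZMod.add_one_ne_self hr i)
      · rfl
      · simp [f] at h
    rwa [this] at key
  · rintro (i | ⟨_ | i, hi⟩) h
    · exact hc i
    · exact absurd rfl h
    · exact (ht i (by omega)).symm
  · rintro (i | ⟨_ | i, hi⟩) h
    · simpa [f] using ZMod.add_one_add_one_ne_self hr i
    · exact absurd rfl h
    · rcases i with _ | i
      · intro e
        have : 0 = 1 := Fin.val_eq_of_eq (Sum.inr_injective e)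
        omega
      · intro e
        have : i = i + 2 := Fin.val_eq_of_eq (Sum.inr_injective e)
        omega
  · intro w hw
    have hcyc := ZMod.sum_cycle_eq_chainEnergy (by omega) (hC w)
    have htail : ∑ i : Fin d, ((T w (i + 1) - T w i) ^ 2 - T w (i + 1) ^ 2) =
        chainEnergy (T w) d :=
      Fin.sum_univ_eq_sum_range (fun i => (T w (i + 1) - T w i) ^ 2 - T w (i + 1) ^ 2) d
    rw [Fintype.sum_sum_type, Fin.sum_univ_succ]
    refine lt_of_eq_of_lt ?_ (hneg w hw)
    have e0 : (Φ w (Sum.inr 0) - Φ w (f (Sum.inr 0))) ^ 2 - Φ w (Sum.inr 0) ^ 2 = - T w 0 ^ 2 := by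
      have : f (Sum.inr 0) = Sum.inr 0 := rfl
      rw [this, sub_self]
      have : Φ w (Sum.inr 0) = T w 0 := rfl
      rw [this]
      ring
    rw [e0, ← hcyc, ← htail]
    have e1 : ∀ i : Fin d, (Φ w (Sum.inr i.succ) - Φ w (f (Sum.inr i.succ))) ^ 2 -
        Φ w (Sum.inr i.succ) ^ 2 = (T w (i + 1) - T w i) ^ 2 - T w (i + 1) ^ 2 := fun i => rfl
    simp_rw [e1]
    change (∑ i : ZMod r, ((C w i.val - C w (i + 1).val) ^ 2 - C w i.val ^ 2)) + _ = _
    ring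

end SimpleGraph

/-! ### Forms in the junction values, and gluing of chains -/

/-- The form `α x² + β x y + γ y²` is negative definite on some linear image of `ℝ^z`. -/
def NegForm (z : ℕ) (α β γ : ℝ) : Prop :=
  ∃ L : (Fin z → ℝ) →ₗ[ℝ] ℝ × ℝ, ∀ w, w ≠ 0 →
    α * (L w).1 ^ 2 + β * (L w).1 * (L w).2 + γ * (L w).2 ^ 2 < 0

theorem negForm_zero (α β γ : ℝ) : NegForm 0 α β γ :=
  ⟨0, fun w hw => absurd (Subsingleton.elim w 0) hw⟩

theorem negForm_one {α β γ : ℝ} (x y : ℝ) (h : α * x ^ 2 + β * x * y + γ * y ^ 2 < 0) :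
    NegForm 1 α β γ := by
  refine ⟨(LinearMap.toSpanSingleton ℝ (ℝ × ℝ) (x, y)).comp (LinearMap.proj 0), fun w hw => ?_⟩
  have hw0 : w 0 ≠ 0 := fun h => hw (funext fun i => by rwa [Subsingleton.elim i 0])
  have hpos := pow_pos (abs_pos.mpr hw0) 2
  rw [sq_abs] at hpos
  have := mul_neg_of_pos_of_neg hpos h
  simp only [LinearMap.comp_apply, LinearMap.toSpanSingleton_apply, LinearMap.proj_apply,
    Prod.smul_mk, smul_eq_mul]
  linarith

theorem negForm_two {α β γ : ℝ} (hα : α < 0) (h : β ^ 2 < 4 * α * γ) : NegForm 2 α β γ := by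
  refine ⟨(LinearMap.proj 0).prod (LinearMap.proj 1), fun w hw => ?_⟩
  change α * w 0 ^ 2 + β * w 0 * w 1 + γ * w 1 ^ 2 < 0
  have key : 4 * α * (α * w 0 ^ 2 + β * w 0 * w 1 + γ * w 1 ^ 2) =
      (2 * α * w 0 + β * w 1) ^ 2 + (4 * α * γ - β ^ 2) * w 1 ^ 2 := by ring
  have hpos : 0 < (2 * α * w 0 + β * w 1) ^ 2 + (4 * α * γ - β ^ 2) * w 1 ^ 2 := by
    by_cases h1 : w 1 = 0
    · have h0 : w 0 ≠ 0 := fun h0 => hw (funext fun i => by fin_cases i <;> simp [h0, h1])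
      have : 2 * α * w 0 ≠ 0 := mul_ne_zero (mul_ne_zero two_ne_zero hα.ne) h0
      have : 0 < (2 * α * w 0) ^ 2 := by positivity
      rw [h1]
      linarith
    · have : 0 < 4 * α * γ - β ^ 2 := by linarith
      positivity
  by_contra hcon
  rw [← key] at hpos
  exact absurd (mul_nonpos_of_nonpos_of_nonneg (by linarith : 4 * α ≤ 0) (not_lt.mp hcon))
    (not_le.mpr hpos)

theorem exists_negForm_two_left (α β : ℝ) {γ : ℝ} (hγ : γ < 0) :
    ∃ N, NegForm 2 (α - N) β γ := by
  refine ⟨|α| + 1 + β ^ 2 / -γ, negForm_two ?_ ?_⟩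
  · have := le_abs_self α
    have : 0 ≤ β ^ 2 / -γ := div_nonneg (sq_nonneg _) (by linarith)
    linarith
  · have h1 : β ^ 2 / -γ * -γ = β ^ 2 := div_mul_cancel₀ _ (by linarith)
    have h2 : 0 ≤ (|α| - α) * -γ := mul_nonneg (by linarith [le_abs_self α]) (by linarith)
    nlinarith [sq_nonneg β]

theorem NegForm.swap {z : ℕ} {α β γ : ℝ} (h : NegForm z α β γ) : NegForm z γ β α := by
  obtain ⟨L, hL⟩ := h
  refine ⟨(LinearMap.snd ℝ ℝ ℝ).prod (LinearMap.fst ℝ ℝ ℝ) ∘ₗ L, fun w hw => ?_⟩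
  have := hL w hw
  change γ * (L w).2 ^ 2 + β * (L w).2 * (L w).1 + α * (L w).1 ^ 2 < 0
  linarith

theorem exists_negForm_two_right {α : ℝ} (β γ : ℝ) (hα : α < 0) :
    ∃ N, NegForm 2 α β (γ - N) := by
  obtain ⟨N, hN⟩ := exists_negForm_two_left γ β hα
  exact ⟨N, hN.swap⟩

section Assembly

variable {r p q a b d M z k₁ k₂ k₃ k₄ : ℕ} {α β γ α' β' γ' τ τ' : ℝ}

theorem NegForm.apply_nonpos {L : (Fin z → ℝ) →ₗ[ℝ] ℝ × ℝ}
    (hL : ∀ w, w ≠ 0 → α * (L w).1 ^ 2 + β * (L w).1 * (L w).2 + γ * (L w).2 ^ 2 < 0)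
    (w : Fin z → ℝ) : α * (L w).1 ^ 2 + β * (L w).1 * (L w).2 + γ * (L w).2 ^ 2 ≤ 0 := by
  by_cases hw : w = 0
  · simp [hw]
  · exact (hL w hw).le

/-- Concatenation of two sequences, the first one used up to the index `a`. -/
def concatMap {A : Type*} [AddCommGroup A] [Module ℝ A] (a : ℕ) (X Y : A →ₗ[ℝ] (ℕ → ℝ)) :
    A →ₗ[ℝ] (ℕ → ℝ) :=
  LinearMap.pi fun i => if i ≤ a then LinearMap.proj i ∘ₗ X else LinearMap.proj (i - a) ∘ₗ Y

theorem concatMap_of_le {A : Type*} [AddCommGroup A] [Module ℝ A] {a : ℕ} (X Y : A →ₗ[ℝ] (ℕ → ℝ))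
    (w : A) {i : ℕ} (h : i ≤ a) : concatMap a X Y w i = X w i := by
  simp [concatMap, LinearMap.pi_apply, h]

theorem concatMap_add {A : Type*} [AddCommGroup A] [Module ℝ A] {a : ℕ} (X Y : A →ₗ[ℝ] (ℕ → ℝ))
    (w : A) (h : X w a = Y w 0) (i : ℕ) : concatMap a X Y w (a + i) = Y w i := by
  rcases Nat.eq_zero_or_pos i with rfl | hi
  · rw [add_zero, concatMap_of_le X Y w le_rfl, h]
  · have : ¬ a + i ≤ a := by omega
    simp [concatMap, LinearMap.pi_apply, this]

theorem chainEnergy_concatMap {A : Type*} [AddCommGroup A] [Module ℝ A] {a : ℕ}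
    (X Y : A →ₗ[ℝ] (ℕ → ℝ)) (w : A) (h : X w a = Y w 0) (b : ℕ) :
    chainEnergy (concatMap a X Y w) (a + b) = chainEnergy (X w) a + chainEnergy (Y w) b := by
  unfold chainEnergy
  rw [Finset.sum_range_add]
  congr 1
  · refine Finset.sum_congr rfl fun i hi => ?_
    have := Finset.mem_range.mp hi
    rw [concatMap_of_le X Y w (by omega), concatMap_of_le X Y w (by omega)]
  · refine Finset.sum_congr rfl fun i _ => ?_
    rw [add_assoc, concatMap_add X Y w h, concatMap_add X Y w h]

/-- The second arc runs from `y` back to `x`, so `γ'` joins `α` and `α'` joins `γ`. Chains do not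
count their starting vertex, so each junction is counted once, as the end of an arc. Strictness in
the chain parameters and in `hz` makes the total negative definite. -/
theorem BoundsCycleTwoTails.le_of_arcs (h : BoundsCycleTwoTails r p q a M) (hab : a + b = r)
    (h₁ : HasArc a k₁ α β γ) (h₂ : HasArc b k₂ α' β' γ') (h₃ : HasTail p k₃ τ)
    (h₄ : HasTail q k₄ τ') (hz : NegForm z (α + γ' + τ) (β + β') (γ + α' + τ')) :
    z + k₁ + k₂ + k₃ + k₄ ≤ M := by
  obtain ⟨Φ₁, H₁⟩ := h₁
  obtain ⟨Φ₂, H₂⟩ := h₂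
  obtain ⟨Φ₃, H₃⟩ := h₃
  obtain ⟨Φ₄, H₄⟩ := h₄
  obtain ⟨L, hL⟩ := hz
  let A := (Fin z → ℝ) × (Fin k₁ → ℝ) × (Fin k₂ → ℝ) × (Fin k₃ → ℝ) × (Fin k₄ → ℝ)
  let P : A →ₗ[ℝ] ℝ × ℝ := L ∘ₗ LinearMap.fst ℝ _ _
  let P' : A →ₗ[ℝ] ℝ × ℝ := (LinearMap.snd ℝ ℝ ℝ).prod (LinearMap.fst ℝ ℝ ℝ) ∘ₗ P
  let s₁ := LinearMap.snd ℝ (Fin z → ℝ) ((Fin k₁ → ℝ) × (Fin k₂ → ℝ) × (Fin k₃ → ℝ) × (Fin k₄ → ℝ))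
  let s₂ := LinearMap.snd ℝ (Fin k₁ → ℝ) ((Fin k₂ → ℝ) × (Fin k₃ → ℝ) × (Fin k₄ → ℝ)) ∘ₗ s₁
  let s₃ := LinearMap.snd ℝ (Fin k₂ → ℝ) ((Fin k₃ → ℝ) × (Fin k₄ → ℝ)) ∘ₗ s₂
  let X : A →ₗ[ℝ] (ℕ → ℝ) := Φ₁ ∘ₗ P.prod (LinearMap.fst ℝ _ _ ∘ₗ s₁)
  let Y : A →ₗ[ℝ] (ℕ → ℝ) := Φ₂ ∘ₗ P'.prod (LinearMap.fst ℝ _ _ ∘ₗ s₂)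
  let S : A →ₗ[ℝ] (ℕ → ℝ) := Φ₃ ∘ₗ P.prod (LinearMap.fst ℝ _ _ ∘ₗ s₃)
  let T : A →ₗ[ℝ] (ℕ → ℝ) := Φ₄ ∘ₗ P'.prod (LinearMap.snd ℝ _ _ ∘ₗ s₃)
  have hXY : ∀ w, X w a = Y w 0 := fun w => (H₁ _ _ _).2.1.trans (H₂ _ _ _).1.symm
  have h0 : ∀ w, concatMap a X Y w 0 = (P w).1 := fun w =>
    (concatMap_of_le X Y w (Nat.zero_le a)).trans (H₁ _ _ _).1
  have key := h A (concatMap a X Y) S T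
    (fun w => by
      rw [h0, ← hab, concatMap_add X Y w (hXY w)]
      exact (H₂ _ _ _).2.1)
    (fun w => (H₃ _ _ _).1.trans (h0 w).symm)
    (fun w => by
      rw [concatMap_of_le X Y w le_rfl, hXY w]
      exact (H₄ _ _ _).1.trans (H₂ _ _ _).1.symm) ?_
  · simpa [A, Module.finrank_prod, add_assoc] using key
  · rintro ⟨w, c₁, c₂, c₃, c₄⟩ hw
    rw [← hab, chainEnergy_concatMap X Y _ (hXY _)]
    obtain ⟨-, -, l₁, t₁⟩ := H₁ (L w).1 (L w).2 c₁
    obtain ⟨-, -, l₂, t₂⟩ := H₂ (L w).2 (L w).1 c₂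
    obtain ⟨-, -, l₃, t₃⟩ := H₃ (L w).1 (L w).2 c₃
    obtain ⟨-, -, l₄, t₄⟩ := H₄ (L w).2 (L w).1 c₄
    have l₀ := NegForm.apply_nonpos hL w
    have t₀ := hL w
    change chainEnergy (Φ₁ (((L w).1, (L w).2), c₁)) a + chainEnergy (Φ₂ (((L w).2, (L w).1), c₂)) b
      + chainEnergy (Φ₃ (((L w).1, (L w).2), c₃)) p
      + chainEnergy (Φ₄ (((L w).2, (L w).1), c₄)) q < 0
    by_cases e₀ : w = 0
    · by_cases e₁ : c₁ = 0
      · by_cases e₂ : c₂ = 0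
        · by_cases e₃ : c₃ = 0
          · by_cases e₄ : c₄ = 0
            · exact absurd (by rw [e₀, e₁, e₂, e₃, e₄]; rfl) hw
            · linarith [t₄ e₄]
          · linarith [t₃ e₃]
        · linarith [t₂ e₂]
      · linarith [t₁ e₁]
    · linarith [t₀ e₀]

/-- Both tails sit at one vertex: the cycle is a single arc with equal end values, so only `α + β +
γ` matters. -/
theorem BoundsCycleTwoTails.le_of_closed_arc (h : BoundsCycleTwoTails r p q 0 M)
    (h₁ : HasArc r k₁ α β γ) (h₃ : HasTail p k₃ τ)
    (h₄ : HasTail q k₄ τ') (hz : NegForm z (α + β + γ + τ + τ') 0 0) :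
    z + k₁ + k₃ + k₄ ≤ M := by
  obtain ⟨Φ₁, H₁⟩ := h₁
  obtain ⟨Φ₃, H₃⟩ := h₃
  obtain ⟨Φ₄, H₄⟩ := h₄
  obtain ⟨L, hL⟩ := hz
  let A := (Fin z → ℝ) × (Fin k₁ → ℝ) × (Fin k₃ → ℝ) × (Fin k₄ → ℝ)
  let P : A →ₗ[ℝ] ℝ × ℝ :=
    (LinearMap.fst ℝ ℝ ℝ).prod (LinearMap.fst ℝ ℝ ℝ) ∘ₗ L ∘ₗ LinearMap.fst ℝ _ _
  let s₁ := LinearMap.snd ℝ (Fin z → ℝ) ((Fin k₁ → ℝ) × (Fin k₃ → ℝ) × (Fin k₄ → ℝ))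
  let s₃ := LinearMap.snd ℝ (Fin k₁ → ℝ) ((Fin k₃ → ℝ) × (Fin k₄ → ℝ)) ∘ₗ s₁
  let X : A →ₗ[ℝ] (ℕ → ℝ) := Φ₁ ∘ₗ P.prod (LinearMap.fst ℝ _ _ ∘ₗ s₁)
  let S : A →ₗ[ℝ] (ℕ → ℝ) := Φ₃ ∘ₗ P.prod (LinearMap.fst ℝ _ _ ∘ₗ s₃)
  let T : A →ₗ[ℝ] (ℕ → ℝ) := Φ₄ ∘ₗ P.prod (LinearMap.snd ℝ _ _ ∘ₗ s₃)
  have key := h A X S T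
    (fun w => (H₁ _ _ _).2.1.trans (H₁ _ _ _).1.symm)
    (fun w => (H₃ _ _ _).1.trans (H₁ _ _ _).1.symm)
    (fun w => (H₄ _ _ _).1.trans (H₁ _ _ _).1.symm) ?_
  · simpa [A, Module.finrank_prod, add_assoc] using key
  · rintro ⟨w, c₁, c₃, c₄⟩ hw
    obtain ⟨-, -, l₁, t₁⟩ := H₁ (L w).1 (L w).1 c₁
    obtain ⟨-, -, l₃, t₃⟩ := H₃ (L w).1 (L w).1 c₃
    obtain ⟨-, -, l₄, t₄⟩ := H₄ (L w).1 (L w).1 c₄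
    have l₀ := NegForm.apply_nonpos hL w
    have t₀ := hL w
    change chainEnergy (Φ₁ (((L w).1, (L w).1), c₁)) r
      + chainEnergy (Φ₃ (((L w).1, (L w).1), c₃)) p
      + chainEnergy (Φ₄ (((L w).1, (L w).1), c₄)) q < 0
    by_cases e₀ : w = 0
    · by_cases e₁ : c₁ = 0
      · by_cases e₃ : c₃ = 0
        · by_cases e₄ : c₄ = 0
          · exact absurd (by rw [e₀, e₁, e₃, e₄]; rfl) hw
          · linarith [t₄ e₄]
        · linarith [t₃ e₃]
      · linarith [t₁ e₁]
    · linarith [t₀ e₀]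

theorem BoundsCyclePath.le_of_closed_arc (h : BoundsCyclePath r d M)
    (h₁ : HasArc r k₁ α β γ) (h₃ : HasTail d k₃ τ)
    (hz : NegForm z (α + β + γ) 0 (τ - 1)) :
    z + k₁ + k₃ ≤ M + 1 := by
  obtain ⟨Φ₁, H₁⟩ := h₁
  obtain ⟨Φ₃, H₃⟩ := h₃
  obtain ⟨L, hL⟩ := hz
  let A := (Fin z → ℝ) × (Fin k₁ → ℝ) × (Fin k₃ → ℝ)
  let P : A →ₗ[ℝ] ℝ × ℝ :=
    (LinearMap.fst ℝ ℝ ℝ).prod (LinearMap.fst ℝ ℝ ℝ) ∘ₗ L ∘ₗ LinearMap.fst ℝ _ _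
  let P' : A →ₗ[ℝ] ℝ × ℝ :=
    (LinearMap.snd ℝ ℝ ℝ).prod (LinearMap.snd ℝ ℝ ℝ) ∘ₗ L ∘ₗ LinearMap.fst ℝ _ _
  let s₁ := LinearMap.snd ℝ (Fin z → ℝ) ((Fin k₁ → ℝ) × (Fin k₃ → ℝ))
  let X : A →ₗ[ℝ] (ℕ → ℝ) := Φ₁ ∘ₗ P.prod (LinearMap.fst ℝ _ _ ∘ₗ s₁)
  let T : A →ₗ[ℝ] (ℕ → ℝ) := Φ₃ ∘ₗ P'.prod (LinearMap.snd ℝ _ _ ∘ₗ s₁)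
  have key := h A X T (fun w => (H₁ _ _ _).2.1.trans (H₁ _ _ _).1.symm) ?_
  · simpa [A, Module.finrank_prod, add_assoc] using key
  · rintro ⟨w, c₁, c₃⟩ hw
    obtain ⟨-, -, l₁, t₁⟩ := H₁ (L w).1 (L w).1 c₁
    obtain ⟨e, -, l₃, t₃⟩ := H₃ (L w).2 (L w).2 c₃
    have l₀ := NegForm.apply_nonpos hL w
    have t₀ := hL w
    change chainEnergy (Φ₁ (((L w).1, (L w).1), c₁)) r
      + chainEnergy (Φ₃ (((L w).2, (L w).2), c₃)) d - Φ₃ (((L w).2, (L w).2), c₃) 0 ^ 2 < 0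
    rw [e]
    by_cases e₀ : w = 0
    · by_cases e₁ : c₁ = 0
      · by_cases e₃ : c₃ = 0
        · exact absurd (by rw [e₀, e₁, e₃]; rfl) hw
        · linarith [t₃ e₃]
      · linarith [t₁ e₁]
    · linarith [t₀ e₀]

end Assembly

/-! ### Dimension counts modulo 3 -/

-- The chain parameters alone give `D0`. The other `D` facts add one or two dimensions from the
-- junction values `(x, y)`, according to residues modulo 3; they suffice in every case because `b`
-- is at least `r / 2`.
set_option maxHeartbeats 400000 in
theorem BoundsCycleTwoTails.bound_of_pos {r p q a M : ℕ} (h : BoundsCycleTwoTails r p q a M)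
    (har : 2 * a ≤ r) (ha : 0 < a) : (p + q + a + 2) / 3 + (r + 5) / 6 ≤ M + 1 := by
  have hmod : ∀ n : ℕ, n % 3 = 0 ∨ n % 3 = 1 ∨ n % 3 = 2 := fun n => by omega
  obtain ⟨b, rfl⟩ : ∃ b, r = a + b := ⟨r - a, by omega⟩
  have hb : 0 < b := by omega
  set m := (a + 2) / 3 - 1 with hm
  set m' := (b + 2) / 3 - 1 with hm'
  obtain ⟨αa, βa, γa, hA⟩ := exists_hasArc ha
  obtain ⟨αb, βb, γb, hB⟩ := exists_hasArc hb
  obtain ⟨τp, hp⟩ := exists_hasTail p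
  obtain ⟨τq, hq⟩ := exists_hasTail q
  rw [← hm] at hA
  rw [← hm'] at hB
  have D0 : m + m' + (p + 1) / 3 + (q + 1) / 3 ≤ M := by
    simpa using h.le_of_arcs rfl hA hB hp hq (negForm_zero _ _ _)
  have Dp : p % 3 = 1 → 1 + m + m' + (p + 1) / 3 + (q + 1) / 3 ≤ M := fun h1 =>
    h.le_of_arcs rfl hA hB (hasTail_of_mod_eq_one h1 (αa + γb + 1)) hq
      (negForm_one 1 0 (by linarith))
  have Dq : q % 3 = 1 → 1 + m + m' + (p + 1) / 3 + (q + 1) / 3 ≤ M := fun h1 =>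
    h.le_of_arcs rfl hA hB hp (hasTail_of_mod_eq_one h1 (γa + αb + 1))
      (negForm_one 0 1 (by linarith))
  have Dpq : p % 3 = 1 → q % 3 = 1 → 2 + m + m' + (p + 1) / 3 + (q + 1) / 3 ≤ M := by
    intro h1 h2
    obtain ⟨N, hN⟩ := exists_negForm_two_left (αa + γb) (βa + βb)
      (γ := γa + αb + -(γa + αb + 1)) (by linarith)
    exact h.le_of_arcs rfl hA hB (hasTail_of_mod_eq_one h1 N) (hasTail_of_mod_eq_one h2 _)
      (by rwa [← sub_eq_add_neg])
  -- The arc parameter is chosen to make the `y ^ 2` coefficient `-1`; a large `N` from the tail at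
  -- `x` then makes the form negative definite in both variables. `Dqa` exchanges the roles of `x`
  -- and `y`.
  have Dpa : p % 3 = 1 → a % 3 = 0 → 2 + m + m' + (p + 1) / 3 + (q + 1) / 3 ≤ M := by
    intro h1 h2
    obtain ⟨N, hN⟩ := exists_negForm_two_left (1 - 2 * ((αb + τq + 1) / 2) + γb)
      ((-1) ^ m * (-4 * ((αb + τq + 1) / 2)) + βb)
      (γ := -2 * ((αb + τq + 1) / 2) + αb + τq) (by linarith)
    exact h.le_of_arcs rfl (hasArc_of_mod_eq_zero h2 ha _) hB (hasTail_of_mod_eq_one h1 N) hq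
      (by rwa [← sub_eq_add_neg])
  have Dqa : q % 3 = 1 → a % 3 = 0 → 2 + m + m' + (p + 1) / 3 + (q + 1) / 3 ≤ M := by
    intro h1 h2
    obtain ⟨N, hN⟩ := exists_negForm_two_right ((-1) ^ m * (-4 * ((γb + τp + 2) / 2)) + βb)
      (-2 * ((γb + τp + 2) / 2) + αb)
      (α := 1 - 2 * ((γb + τp + 2) / 2) + γb + τp) (by linarith)
    exact h.le_of_arcs rfl (hasArc_of_mod_eq_zero h2 ha _) hB hp (hasTail_of_mod_eq_one h1 N)
      (by rwa [← sub_eq_add_neg])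
  -- At `(1, (-1) ^ m)` the arc contributes `1 - 8 * t`, and `t` is taken to outweigh all other
  -- coefficients.
  have Da : a % 3 = 0 → 1 + m + m' + (p + 1) / 3 + (q + 1) / 3 ≤ M := by
    intro h1
    refine h.le_of_arcs rfl (hasArc_of_mod_eq_zero h1 ha
      (1 + |γb| + |τp| + |βb| + |αb| + |τq|)) hB hp hq (negForm_one 1 ((-1) ^ m) ?_)
    have := abs_nonneg γb
    have := abs_nonneg τp
    have := abs_nonneg βb
    have := abs_nonneg αb
    have := abs_nonneg τq
    have := le_abs_self γb
    have := le_abs_self τp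
    have := le_abs_self βb
    have := neg_abs_le βb
    have := le_abs_self αb
    have := le_abs_self τq
    rw [← hm]
    rcases neg_one_pow_eq_or ℝ m with hσ | hσ <;> rw [hσ] <;> linarith
  have Db : b % 3 = 0 → 1 + m + m' + (p + 1) / 3 + (q + 1) / 3 ≤ M := by
    intro h1
    refine h.le_of_arcs rfl hA (hasArc_of_mod_eq_zero h1 hb
      (1 + |γa| + |τp| + |βa| + |αa| + |τq|)) hp hq (negForm_one 1 ((-1) ^ m') ?_)
    have := abs_nonneg γa
    have := abs_nonneg τp
    have := abs_nonneg βa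
    have := abs_nonneg αa
    have := abs_nonneg τq
    have := le_abs_self γa
    have := le_abs_self τp
    have := le_abs_self βa
    have := neg_abs_le βa
    have := le_abs_self αa
    have := le_abs_self τq
    rw [← hm']
    rcases neg_one_pow_eq_or ℝ m' with hσ | hσ <;> rw [hσ] <;> linarith
  -- With `m = m'` the cross terms of the two arcs have the same sign and reinforce each other at
  -- `(1, (-1) ^ m)`.
  have Dsmall : p % 3 = 0 → q % 3 = 0 → a % 3 ≠ 0 → b % 3 ≠ 0 → m = m' →
      1 + m + m' + (p + 1) / 3 + (q + 1) / 3 ≤ M := by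
    intro h1 h2 h3 h4 hmm
    have A1 : a % 3 = 1 → _ := hasArc_of_mod_eq_one (n := a)
    have A2 : a % 3 = 2 → _ := hasArc_of_mod_eq_two (n := a)
    have B1 : b % 3 = 1 → _ := hasArc_of_mod_eq_one (n := b)
    have B2 : b % 3 = 2 → _ := hasArc_of_mod_eq_two (n := b)
    rw [← hm] at A1 A2
    rw [← hm', ← hmm] at B1 B2
    rw [← hmm]
    have hp := hasTail_of_mod_eq_zero h1
    have hq := hasTail_of_mod_eq_zero h2
    obtain h5 | h5 : a % 3 = 1 ∨ a % 3 = 2 := by omega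
    all_goals obtain h6 | h6 : b % 3 = 1 ∨ b % 3 = 2 := by omega
    · refine h.le_of_arcs rfl (A1 h5) (B1 h6) hp hq (negForm_one 1 ((-1) ^ m) ?_)
      rcases neg_one_pow_eq_or ℝ m with hσ | hσ <;> rw [hσ] <;> norm_num
    · refine h.le_of_arcs rfl (A1 h5) (B2 h6) hp hq (negForm_one 1 ((-1) ^ m) ?_)
      rcases neg_one_pow_eq_or ℝ m with hσ | hσ <;> rw [hσ] <;> norm_num
    · refine h.le_of_arcs rfl (A2 h5) (B1 h6) hp hq (negForm_one 1 ((-1) ^ m) ?_)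
      rcases neg_one_pow_eq_or ℝ m with hσ | hσ <;> rw [hσ] <;> norm_num
    · exact h.le_of_arcs rfl (A2 h5) (B2 h6) hp hq (negForm_one 1 0 (by norm_num))
  have D22 : p % 3 = 0 → q % 3 = 0 → a % 3 = 2 → b % 3 = 2 →
      1 + m + m' + (p + 1) / 3 + (q + 1) / 3 ≤ M := fun h1 h2 h5 h6 =>
    h.le_of_arcs rfl (hasArc_of_mod_eq_two h5) (hasArc_of_mod_eq_two h6)
      (hasTail_of_mod_eq_zero h1) (hasTail_of_mod_eq_zero h2) (negForm_one 1 0 (by norm_num))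
  have Dp2 : p % 3 = 2 → q % 3 = 0 → a % 3 = 2 → (b % 3 = 1 ∧ m = m' ∨ b % 3 = 2) →
      1 + m + m' + (p + 1) / 3 + (q + 1) / 3 ≤ M := by
    intro h1 h2 h5 h6
    have hp := hasTail_of_mod_eq_two h1
    have hq := hasTail_of_mod_eq_zero h2
    rcases h6 with ⟨h6, hmm⟩ | h6
    · refine h.le_of_arcs rfl (hasArc_of_mod_eq_two h5) (hasArc_of_mod_eq_one h6) hp hq
        (negForm_one 1 ((-1) ^ m) ?_)
      rw [← hm, ← hm', ← hmm]
      rcases neg_one_pow_eq_or ℝ m with hσ | hσ <;> rw [hσ] <;> norm_num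
    · exact h.le_of_arcs rfl (hasArc_of_mod_eq_two h5) (hasArc_of_mod_eq_two h6) hp hq
        (negForm_one 0 1 (by norm_num))
  have Dq2 : p % 3 = 0 → q % 3 = 2 → a % 3 = 2 → (b % 3 = 1 ∧ m = m' ∨ b % 3 = 2) →
      1 + m + m' + (p + 1) / 3 + (q + 1) / 3 ≤ M := by
    intro h1 h2 h5 h6
    have hp := hasTail_of_mod_eq_zero h1
    have hq := hasTail_of_mod_eq_two h2
    rcases h6 with ⟨h6, hmm⟩ | h6
    · refine h.le_of_arcs rfl (hasArc_of_mod_eq_two h5) (hasArc_of_mod_eq_one h6) hp hq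
        (negForm_one 1 ((-1) ^ m) ?_)
      rw [← hm, ← hm', ← hmm]
      rcases neg_one_pow_eq_or ℝ m with hσ | hσ <;> rw [hσ] <;> norm_num
    · exact h.le_of_arcs rfl (hasArc_of_mod_eq_two h5) (hasArc_of_mod_eq_two h6) hp hq
        (negForm_one 1 0 (by norm_num))
  clear_value m m'
  clear hA hB hp hq
  obtain hp | hp | hp : p % 3 = 0 ∨ p % 3 = 1 ∨ p % 3 = 2 := hmod p
  all_goals obtain hq | hq | hq : q % 3 = 0 ∨ q % 3 = 1 ∨ q % 3 = 2 := hmod q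
  · by_cases h3 : a % 3 = 0
    · have := Da h3
      clear * - this har ha hm hm' hp hq h3
      omega
    by_cases h4 : b % 3 = 0
    · have := Db h4
      clear * - this har ha hm hm' hp hq h3 h4
      omega
    by_cases hmm : m = m'
    · have := Dsmall hp hq h3 h4 hmm
      clear * - this har ha hm hm' hp hq h3 h4 hmm
      omega
    by_cases h5 : a % 3 = 2 ∧ b % 3 = 2
    · have := D22 hp hq h5.1 h5.2
      clear * - this har ha hm hm' hp hq h5
      omega
    · have := D0
      clear * - this har ha hm hm' hp hq h3 h4 h5 hmm
      omega
  · by_cases h3 : a % 3 = 0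
    · have := Dqa hq h3
      clear * - this har ha hm hm' hp hq h3
      omega
    · have := Dq hq
      clear * - this har ha hm hm' hp hq h3
      omega
  · by_cases h3 : a % 3 = 0
    · have := Da h3
      clear * - this har ha hm hm' hp hq h3
      omega
    by_cases h4 : b % 3 = 0
    · have := Db h4
      clear * - this har ha hm hm' hp hq h3 h4
      omega
    by_cases h5 : a % 3 = 2 ∧ (b % 3 = 1 ∧ m = m' ∨ b % 3 = 2)
    · have := Dq2 hp hq h5.1 h5.2
      clear * - this har ha hm hm' hp hq h5
      omega
    · have := D0
      clear * - this har ha hm hm' hp hq h3 h4 h5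
      omega
  · by_cases h3 : a % 3 = 0
    · have := Dpa hp h3
      clear * - this har ha hm hm' hp hq h3
      omega
    · have := Dp hp
      clear * - this har ha hm hm' hp hq h3
      omega
  · have := Dpq hp hq
    clear * - this har ha hm hm' hp hq
    omega
  · have := Dp hp
    clear * - this har ha hm hm' hp hq
    omega
  · by_cases h3 : a % 3 = 0
    · have := Da h3
      clear * - this har ha hm hm' hp hq h3
      omega
    by_cases h4 : b % 3 = 0
    · have := Db h4
      clear * - this har ha hm hm' hp hq h3 h4
      omega
    by_cases h5 : a % 3 = 2 ∧ (b % 3 = 1 ∧ m = m' ∨ b % 3 = 2)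
    · have := Dp2 hp hq h5.1 h5.2
      clear * - this har ha hm hm' hp hq h5
      omega
    · have := D0
      clear * - this har ha hm hm' hp hq h3 h4 h5
      omega
  · have := Dq hq
    clear * - this har ha hm hm' hp hq
    omega
  · by_cases h3 : a % 3 = 0
    · have := Da h3
      clear * - this har ha hm hm' hp hq h3
      omega
    · have := D0
      clear * - this har ha hm hm' hp hq h3
      omega

/-- Rounding is short by one only when some tail has length 1 modulo 3, and that tail makes the
common junction value a negative direction. -/
theorem BoundsCycleTwoTails.bound_of_zero {r p q M : ℕ} (h : BoundsCycleTwoTails r p q 0 M)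
    (hr : 3 ≤ r) : (p + q + 2) / 3 + (r + 5) / 6 ≤ M + 1 := by
  obtain ⟨α, β, γ, hA⟩ := exists_hasArc (show 0 < r by omega)
  obtain ⟨τp, hp⟩ := exists_hasTail p
  obtain ⟨τq, hq⟩ := exists_hasTail q
  have D0 := h.le_of_closed_arc hA hp hq (negForm_zero _ _ _)
  have Dp : p % 3 = 1 → 1 + ((r + 2) / 3 - 1) + (p + 1) / 3 + (q + 1) / 3 ≤ M := fun h1 =>
    h.le_of_closed_arc hA (hasTail_of_mod_eq_one h1 (α + β + γ + τq + 1)) hq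
      (negForm_one 1 0 (by linarith))
  have Dq : q % 3 = 1 → 1 + ((r + 2) / 3 - 1) + (p + 1) / 3 + (q + 1) / 3 ≤ M := fun h1 =>
    h.le_of_closed_arc hA hp (hasTail_of_mod_eq_one h1 (α + β + γ + τp + 1))
      (negForm_one 1 0 (by linarith))
  omega

theorem BoundsCycleTwoTails.bound {r p q a M : ℕ} (h : BoundsCycleTwoTails r p q a M)
    (hr : 3 ≤ r) (har : 2 * a ≤ r) : (p + q + a + 2) / 3 + (r + 5) / 6 ≤ M + 1 := by
  rcases Nat.eq_zero_or_pos a with rfl | ha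
  · exact h.bound_of_zero hr
  · exact h.bound_of_pos har ha

theorem BoundsCyclePath.bound {r d M : ℕ} (h : BoundsCyclePath r d M) (hr : 3 ≤ r) :
    (d + 2) / 3 + (r + 5) / 6 ≤ M + 1 := by
  obtain ⟨α, β, γ, hA⟩ := exists_hasArc (show 0 < r by omega)
  obtain ⟨τ, hd⟩ := exists_hasTail d
  have D0 := h.le_of_closed_arc hA hd (negForm_zero _ _ _)
  have D1 : d % 3 = 1 → 1 + ((r + 2) / 3 - 1) + (d + 1) / 3 ≤ M + 1 := fun h1 =>
    h.le_of_closed_arc hA (hasTail_of_mod_eq_one h1 0) (negForm_one 0 1 (by norm_num))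
  -- For `r ≥ 4` the arc parameters already number at least `⌈r / 6⌉`. A triangle has none; `t = 1`
  -- makes its closed form `-7 * x ^ 2`, which supplies the missing dimension.
  have hA3 : r = 3 → HasArc r ((r + 2) / 3 - 1) (1 - 2 * 1) (-4 * 1) (-2 * 1) := by
    rintro rfl
    exact hasArc_three 1
  have D2 : r = 3 → 1 + ((r + 2) / 3 - 1) + (d + 1) / 3 ≤ M + 1 := fun h3 =>
    h.le_of_closed_arc (hA3 h3) hd (negForm_one 1 0 (by norm_num))
  have D3 : r = 3 → d % 3 = 1 → 2 + ((r + 2) / 3 - 1) + (d + 1) / 3 ≤ M + 1 := fun h3 h1 =>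
    h.le_of_closed_arc (hA3 h3) (hasTail_of_mod_eq_one h1 0) (negForm_two (by norm_num)
      (by norm_num))
  omega

/-! ### The cycle and a diametral path -/

/-- Every cycle has the edge set of the unique one, so deleting one of its edges `e` leaves an
acyclic graph. This lies in a spanning tree, which together with `e` covers all edges. -/
theorem IsUnicyclic.card_edgeFinset_le {V : Type*} [Fintype V] [DecidableEq V]
    {G : SimpleGraph V} [DecidableRel G.Adj] (hG : IsUnicyclic G) :
    G.edgeFinset.card ≤ Fintype.card V := by
  classical
  obtain ⟨hconn, H, ⟨v, w, hw, rfl⟩, huniq⟩ := hG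
  obtain ⟨e, he⟩ : ∃ e, e ∈ w.edges :=
    List.exists_mem_of_length_pos (by rw [w.length_edges]; have := hw.three_le_length; omega)
  have hle : G.deleteEdges {e} ≤ G := G.deleteEdges_le _
  have hac : (G.deleteEdges {e}).IsAcyclic := by
    intro u w' hw'
    have h1 := huniq _ ⟨u, w'.mapLe hle, hw'.mapLe hle, rfl⟩
    have h2 : e ∈ (w'.mapLe hle).edges := by
      rw [← SimpleGraph.Walk.mem_edges_toSubgraph, h1, SimpleGraph.Walk.mem_edges_toSubgraph]
      exact he
    rw [SimpleGraph.Walk.edges_mapLe_eq_edges] at h2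
    have h3 := w'.edges_subset_edgeSet h2
    simp at h3
  obtain ⟨T, hT, -, htree⟩ := hconn.exists_isTree_le_of_le_of_isAcyclic hle hac
  have hsub : G.edgeFinset ⊆ insert e T.edgeFinset := by
    intro f hf
    by_cases hfe : f = e
    · simp [hfe]
    · refine Finset.mem_insert_of_mem ?_
      rw [SimpleGraph.mem_edgeFinset] at hf ⊢
      exact SimpleGraph.edgeSet_mono hT (by simp [hf, hfe])
  have := Finset.card_le_card hsub
  have := Finset.card_insert_le e T.edgeFinset
  have := htree.card_edgeFinset
  omega

theorem Nat.ceil_div_le_of_add (n k : ℕ) (hk : 0 < k) :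
    ⌈(n : ℝ) / k⌉ ≤ (((n + (k - 1)) / k : ℕ) : ℤ) := by
  rw [Int.ceil_le, div_le_iff₀ (by exact_mod_cast hk)]
  have h := Nat.div_add_mod (n + (k - 1)) k
  have h' := Nat.mod_lt (n + (k - 1)) hk
  have : n ≤ (n + (k - 1)) / k * k := by
    rw [mul_comm]
    omega
  exact_mod_cast this

namespace SimpleGraph

variable {V : Type*} {G : SimpleGraph V}

theorem Connected.dist_le_of_adj_succ (hG : G.Connected) {X : ℕ → V} {n : ℕ}
    (hX : ∀ i < n, G.Adj (X i) (X (i + 1))) : G.dist (X 0) (X n) ≤ n := by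
  induction n with
  | zero => simp
  | succ n ih =>
    have h1 := ih fun i hi => hX i (by omega)
    have h2 := hG.dist_triangle (u := X 0) (v := X n) (w := X (n + 1))
    have h3 := dist_eq_one_iff_adj.mpr (hX n (by omega))
    omega

theorem Walk.IsCycle.exists_zmod {v : V} {w : G.Walk v v} (hw : w.IsCycle) :
    ∃ c : ZMod w.length → V, Function.Injective c ∧ ∀ i, G.Adj (c i) (c (i + 1)) := by
  have h3 := hw.three_le_length
  have : NeZero w.length := ⟨by omega⟩
  refine ⟨fun i => w.getVert i.val, fun i j hij => ?_, fun i => ?_⟩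
  · have hi := i.val_lt
    have hj := j.val_lt
    exact ZMod.val_injective _ (hw.getVert_injOn' (by simp only [Set.mem_ofPred_eq]; omega)
      (by simp only [Set.mem_ofPred_eq]; omega) hij)
  · change G.Adj (w.getVert i.val) (w.getVert (i + 1).val)
    rw [ZMod.apply_val_add_one (X := w.getVert) (by omega) (by simp)]
    exact w.adj_getVert_succ i.val_lt

/-- A cycle can be rotated and reflected so that a given vertex comes first and another one comes at
most half-way around. -/
theorem exists_cycle_reindex {r : ℕ} [NeZero r] {c : ZMod r → V}
    (hinj : Function.Injective c) (hc : ∀ i, G.Adj (c i) (c (i + 1))) (x y : ZMod r) :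
    ∃ (c' : ZMod r → V) (a : ℕ), Function.Injective c' ∧ (∀ i, G.Adj (c' i) (c' (i + 1))) ∧
      (∀ i, c' i ∈ Set.range c) ∧ 2 * a ≤ r ∧ a < r ∧ c' 0 = c x ∧ c' a = c y := by
  have hpos := Nat.pos_of_ne_zero (NeZero.ne r)
  by_cases h : 2 * (y - x).val ≤ r
  · refine ⟨fun i => c (x + i), (y - x).val, fun i j hij => add_left_cancel (hinj hij),
      fun i => ?_, fun i => ⟨_, rfl⟩, h, (y - x).val_lt, by simp, by simp⟩
    simpa only [add_assoc] using hc (x + i)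
  · have hne : NeZero (y - x) := ⟨fun h0 => by simp [h0] at h⟩
    have hval : (x - y).val = r - (y - x).val := by
      rw [← ZMod.val_neg_of_ne_zero, neg_sub]
    refine ⟨fun i => c (x - i), (x - y).val, fun i j hij => sub_right_injective (hinj hij),
      fun i => ?_, fun i => ⟨_, rfl⟩, by omega, (x - y).val_lt, by simp, by simp⟩
    have := (hc (x - (i + 1))).symm
    rwa [show x - (i + 1) + 1 = x - i by ring] at this

variable [Fintype V] [DecidableEq V] [DecidableRel G.Adj]

theorem Connected.diam_girth_bound (hG : G.Connected) (hE : G.edgeFinset.card ≤ Fintype.card V)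
    {r d : ℕ} (hr : 3 ≤ r) {c : ZMod r → V} (hinj : Function.Injective c)
    (hc : ∀ i, G.Adj (c i) (c (i + 1))) {P : ℕ → V} (hP : Set.InjOn P {i | i ≤ d})
    (hadj : ∀ i < d, G.Adj (P i) (P (i + 1))) (hd : G.dist (P 0) (P d) = d) :
    (d + 2) / 3 + (r + 5) / 6 ≤ numLaplacianEigenvalues G (Set.Ico (0 : ℝ) 1) + 1 := by
  classical
  have : NeZero r := ⟨by omega⟩
  by_cases hmeet : ∃ i, i ≤ d ∧ P i ∈ Set.range c
  · obtain ⟨hi₀, x, hx⟩ := Nat.find_spec hmeet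
    have hmin := fun i => Nat.find_min hmeet (m := i)
    set i₀ := Nat.find hmeet
    obtain ⟨y, hy⟩ := Nat.findGreatest_spec (P := fun i => P i ∈ Set.range c) hi₀ ⟨x, hx⟩
    have hij : i₀ ≤ Nat.findGreatest (fun i => P i ∈ Set.range c) d :=
      Nat.le_findGreatest hi₀ ⟨x, hx⟩
    have hj₀ : Nat.findGreatest (fun i => P i ∈ Set.range c) d ≤ d := Nat.findGreatest_le d
    have hmax := fun k => Nat.findGreatest_is_greatest (P := fun i => P i ∈ Set.range c)
      (n := d) (k := k)
    set j₀ := Nat.findGreatest (fun i => P i ∈ Set.range c) d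
    obtain ⟨c', a, hinj', hc', hmem, h2a, har, h0, ha⟩ := exists_cycle_reindex hinj hc x y
    -- The stretch of the path between its first and last meeting with the cycle is replaced by the
    -- arc of `a` edges; the path is a geodesic, so the new route is no shorter.
    have hdist : d ≤ i₀ + a + (d - j₀) := by
      have h1 := hG.dist_le_of_adj_succ (X := P) (n := i₀) fun i hi => hadj i (by omega)
      have h2 := hG.dist_le_of_adj_succ (X := fun i => c' i) (n := a) fun i _ => by
        simpa using hc' i
      have h3 := hG.dist_le_of_adj_succ (X := fun i => P (j₀ + i)) (n := d - j₀) fun i hi =>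
        hadj (j₀ + i) (by omega)
      simp only [Nat.cast_zero, h0, ha, hx, hy, add_zero] at h2 h3
      rw [show j₀ + (d - j₀) = d by omega] at h3
      have h4 := hG.dist_triangle (u := P 0) (v := P i₀) (w := P d)
      have h5 := hG.dist_triangle (u := P i₀) (v := P j₀) (w := P d)
      omega
    have key := (G.boundsCycleTwoTails hE (p := i₀) (q := d - j₀) hr har c' (fun i => P (i₀ - i))
      (fun i => P (j₀ + i)) ?_ hc' ?_ ?_ ?_ ?_).bound hr h2a
    · omega
    · refine hinj'.sumElim (Function.Injective.sumElim ?_ ?_ ?_) ?_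
      · intro i j h
        have := hP (by simp only [Set.mem_ofPred_eq]; omega)
          (by simp only [Set.mem_ofPred_eq]; omega) h
        exact Fin.ext (by omega)
      · intro i j h
        have := hP (by simp only [Set.mem_ofPred_eq]; omega)
          (by simp only [Set.mem_ofPred_eq]; omega) h
        exact Fin.ext (by omega)
      · intro i j h
        have := hP (by simp only [Set.mem_ofPred_eq]; omega)
          (by simp only [Set.mem_ofPred_eq]; omega) h
        omega
      · rintro k (i | i) h
        · exact hmin (i₀ - (i + 1)) (by omega) ⟨by omega, by simpa [h] using hmem k⟩
        · exact hmax (j₀ + (i + 1)) (by omega) (by omega) (by simpa [h] using hmem k)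
    · intro i hi
      have := hadj (i₀ - (i + 1)) (by omega)
      rw [show i₀ - (i + 1) + 1 = i₀ - i by omega] at this
      exact this.symm
    · exact fun i hi => hadj (j₀ + i) (by omega)
    · exact hx.symm.trans h0.symm
    · exact hy.symm.trans ha.symm
  · refine (G.boundsCyclePath hE hr c P (hinj.sumElim ?_ ?_) hc hadj).bound hr
    · exact fun i j h => Fin.ext (hP (by simp only [Set.mem_ofPred_eq]; omega)
          (by simp only [Set.mem_ofPred_eq]; omega) h)
    · exact fun k i h => hmeet ⟨i, by omega, k, h⟩

end SimpleGraph

theorem mainTheorem1 {V : Type*} [Fintype V] [DecidableEq V]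
    (G : SimpleGraph V) [DecidableRel G.Adj] (hG : IsUnicyclic G) :
    ⌈(G.diam : ℝ) / 3⌉ + ⌈(G.girth : ℝ) / 6⌉ - 1 ≤
      (numLaplacianEigenvalues G (Set.Ico (0 : ℝ) 1) : ℤ) := by
  have hE := hG.card_edgeFinset_le
  obtain ⟨hconn, H, ⟨v₀, w₀, hw₀, -⟩, -⟩ := hG
  obtain ⟨v, w, hw, hgirth⟩ := SimpleGraph.exists_girth_eq_length.mpr fun h => h w₀ hw₀
  obtain ⟨c, hinj, hc⟩ := hw.exists_zmod
  have := hconn.nonempty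
  obtain ⟨s, t, hst⟩ := G.exists_dist_eq_diam
  obtain ⟨P, hP, hlen⟩ := hconn.exists_path_of_dist s t
  have key := hconn.diam_girth_bound hE hw.three_le_length hinj hc (P := P.getVert) (d := P.length)
    hP.getVert_injOn (fun i hi => P.adj_getVert_succ hi)
    (by rw [SimpleGraph.Walk.getVert_zero, SimpleGraph.Walk.getVert_length, hlen])
  rw [hlen, hst, ← hgirth] at key
  have h3 := Nat.ceil_div_le_of_add G.diam 3 (by norm_num)
  have h6 := Nat.ceil_div_le_of_add G.girth 6 (by norm_num)
  norm_num only [Nat.cast_ofNat] at h3 h6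
  push_cast at h3 h6
  omega
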